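/- Let $T$ and $M$ be the numbers of tasks and kernels. For each task $t\in\{1,\dots,T\}$ let $(x_i^t,y_i^t)$, $i=1,\dots,N_t$, be training samples with $x_i^t$ in a set $X$ and labels $y_i^t\in\{-1,1\}$. For $m\in\{1,\dots,M\}$ let $\mathcal H_m$ be a reproducing kernel Hilbert space of real functions on $X$ with reproducing kernel $k_m$. Let $C>0$, $p,s\in[1,\infty]$, and let $q=\frac{p}{p-1}$ (with $q=\infty$ if $p=1$ and $q=1$ if $p=\infty$). For an exponent $r\in[1,\infty]$ put $\bar B_r=\{v \mid v\succeq 0,\ \|v\|_r\le 1\}$, a subset of $\mathbb R^M$ or $\mathbb R^T$ as appropriate. Multi-task MKL problem: minimize $\|(g^1,\dots,g^T)\|_p$, where $$g^t=\sum_{m=1}^M\frac{\|f_m^t\|_{\mathcal H_m}^2}{2\theta_m}+C\sum_{i=1}^{N_t}\xi_i^t$$ (with $0/0=0$ and $a/0=+\infty$ for $a>0$), over all $f_m^t\in\mathcal H_m$, $b^t\in\mathbb R$, $\xi^t\in\mathbb R^{N_t}$ with $\xi^t\succeq 0$, and $\theta\in\bar B_s\subset\mathbb R^M$, subject to $y_i^t\bigl(\sum_m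 f_m^t(x_i^t)+b^t\bigr)\ge 1-\xi_i^t$ for all $t$ and $i$. Min-max problem: $$\min_{\theta\in\bar B_s}\ \max_{\beta,\lambda}\ \Phi(\theta,\beta,\lambda),\qquad \Phi(\theta,\beta,\lambda)=\sum_{t=1}^T\Bigl({\beta^t}'\mathbf 1-\frac{1}{2\lambda^t}{\beta^t}'{Y^t}'\Bigl(\sum_{m=1}^M\theta_mK_m^t\Bigr)Y^t\beta^t\Bigr),$$ where $Y^t$ is the diagonal matrix with diagonal $y^t=(y_1^t,\dots,y_{N_t}^t)'$, $K_m^t=(k_m(x_i^t,x_j^t))_{i,j}$, and the maximum is over $\lambda\in\bar B_q\subset\mathbb R^T$ and $\beta^t\in\mathbb R^{N_t}$ with ${\beta^t}'y^t=0$ and $0\preceq\beta^t\preceq\lambda^tC\mathbf 1$ for all $t$ (if $\lambda^t=0$, then $\beta^t=0$ and the $t$-th summand of $\Phi$ is $0$). Theorem. The two problems are equivalent, in the following sense. For every $\theta\in\bar B_s$ the inner maximum over $(\beta,\lambda)$ is attained, and it equals the minimum of the multi-task objective over $(f,\xi,b)$ for this fixed $\theta$, which is attained too. Both problems attain their optimal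 values, and these values are equal. A vector $\theta$ is the $\theta$-component of an optimal solution $(f,\theta,\xi,b)$ of the multi-task problem if and only if it is the $\theta$-component of a solution $(\theta,\beta,\lambda)$ of the min-max problem, that is, $\theta$ minimizes the inner maximum over $\bar B_s$ and $(\beta,\lambda)$ attains the inner maximum at $\theta$. -/

import Mathlib

open scoped ENNReal Matrix

noncomputable section

namespace MTMKL

/-- Training samples of `T` binary classification tasks: task `t` has `N t` samples `x t i` in the
input space `X`, with labels `y t i = ±1`. -/
structure TrainingData (X : Type*) (T : ℕ) where
  N : Fin T → ℕ
  x : (t : Fin T) → Fin (N t) → X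
  y : (t : Fin T) → Fin (N t) → ℝ
  label : ∀ t i, y t i = 1 ∨ y t i = -1

/-- `ν(v)_p`: the Minkowski `ℓ_p` norm of a finite real vector (the maximum norm for `p = ∞`). -/
def nu {n : ℕ} (p : ℝ≥0∞) (v : Fin n → ℝ) : ℝ :=
  ‖(WithLp.toLp p v : PiLp p (fun _ : Fin n => ℝ))‖

/-- The nonnegative part of the closed unit ball of `ℓ_s`: all `v ⪰ 0` with `ν(v)_s ≤ 1`. -/
def posBall (n : ℕ) (s : ℝ≥0∞) : Set (Fin n → ℝ) :=
  {v | (∀ i, 0 ≤ v i) ∧ nu s v ≤ 1}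

/-- The scalar reproducing kernel `k(x, x')` of a reproducing kernel Hilbert space of real
functions. Mathlib's kernel takes values in the continuous linear maps `ℝ → ℝ`, each of which is
multiplication by a number. -/
def kernelFun {X : Type*} (H : Type*) [NormedAddCommGroup H] [InnerProductSpace ℝ H]
    [CompleteSpace H] [RKHS ℝ H X ℝ] (x x' : X) : ℝ :=
  RKHS.kernel H x x' 1

section Problem

variable {X : Type*} {T M : ℕ} (D : TrainingData X T) (C : ℝ) (p s : ℝ≥0∞)
  (H : Fin M → Type*) [∀ m, NormedAddCommGroup (H m)] [∀ m, InnerProductSpace ℝ (H m)]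
  [∀ m, CompleteSpace (H m)] [∀ m, RKHS ℝ (H m) X ℝ]

/-- The multi-kernel SVM objective of task `t`,
`∑ₘ ‖fₘᵗ‖² / (2 θₘ) + C ∑ᵢ ξᵢᵗ`. -/
def svmObjective (f : (t : Fin T) → (m : Fin M) → H m) (θ : Fin M → ℝ)
    (ξ : (t : Fin T) → Fin (D.N t) → ℝ) (t : Fin T) : ℝ :=
  ∑ m, ‖f t m‖ ^ 2 / (2 * θ m) + C * ∑ i, ξ t i

/-- The objective `ν(g(f, θ, ξ))_p` of the multi-task problem. -/
def primalObjective (f : (t : Fin T) → (m : Fin M) → H m) (θ : Fin M → ℝ)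
    (ξ : (t : Fin T) → Fin (D.N t) → ℝ) : ℝ :=
  nu p (svmObjective D C H f θ ξ)

/-- Feasibility of `(f, θ, ξ, b)` for the multi-task problem. The field `finite` expresses the
usual convention `0 / 0 = 0` and `a / 0 = +∞` for `a > 0` in the terms `‖fₘᵗ‖² / (2 θₘ)`: points
at which the objective is `+∞` are left out, and at all others the real-valued
objective above is the intended one. -/
structure PrimalFeasible (f : (t : Fin T) → (m : Fin M) → H m) (θ : Fin M → ℝ)
    (ξ : (t : Fin T) → Fin (D.N t) → ℝ) (b : Fin T → ℝ) : Prop where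
  margin : ∀ t i, D.y t i * (∑ m, f t m (D.x t i) + b t) ≥ 1 - ξ t i
  slack : ∀ t i, 0 ≤ ξ t i
  ball : θ ∈ posBall M s
  finite : ∀ t m, θ m = 0 → f t m = 0

/-- Objective values of the multi-task problem with the kernel weights `θ` held fixed. -/
def primalValuesAt (θ : Fin M → ℝ) : Set ℝ :=
  {r | ∃ f ξ b, PrimalFeasible D s H f θ ξ b ∧ r = primalObjective D C p H f θ ξ}

/-- Objective values of the multi-task problem. -/
def primalValues : Set ℝ :=
  {r | ∃ f θ ξ b, PrimalFeasible D s H f θ ξ b ∧ r = primalObjective D C p H f θ ξ}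

/-- `(f, θ, ξ, b)` is an optimal solution of the multi-task problem. -/
def IsPrimalSolution (f : (t : Fin T) → (m : Fin M) → H m) (θ : Fin M → ℝ)
    (ξ : (t : Fin T) → Fin (D.N t) → ℝ) (b : Fin T → ℝ) : Prop :=
  PrimalFeasible D s H f θ ξ b ∧
    ∀ f' θ' ξ' b', PrimalFeasible D s H f' θ' ξ' b' →
      primalObjective D C p H f θ ξ ≤ primalObjective D C p H f' θ' ξ'

/-- The kernel matrix of the `m`-th kernel on the samples of task `t`. -/
def kernelMatrix (m : Fin M) (t : Fin T) : Matrix (Fin (D.N t)) (Fin (D.N t)) ℝ :=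
  Matrix.of fun i j => kernelFun (H m) (D.x t i) (D.x t j)

/-- The diagonal matrix of the labels of task `t`. -/
def labelMatrix (t : Fin T) : Matrix (Fin (D.N t)) (Fin (D.N t)) ℝ :=
  Matrix.diagonal (D.y t)

/-- `Φ(θ, β, λ)`. If `λᵗ = 0`, the constraints below force `βᵗ = 0`, and the `t`-th summand is `0`
(`1 / 0 = 0` here). -/
def Phi (θ : Fin M → ℝ) (β : (t : Fin T) → Fin (D.N t) → ℝ) (lam : Fin T → ℝ) : ℝ :=
  ∑ t, (β t ⬝ᵥ (fun _ => 1) - 1 / (2 * lam t) *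
    (β t ⬝ᵥ (((labelMatrix D t)ᵀ * (∑ m, θ m • kernelMatrix D H m t) * labelMatrix D t) *ᵥ β t)))

/-- Feasibility of `(β, λ)`: `βᵗ'yᵗ = 0` and `0 ⪯ βᵗ ⪯ λᵗ C 1` for all `t`, `λ ⪰ 0` and
`‖λ‖_q ≤ 1`. Here `q = ENNReal.conjExponent p` is the conjugate exponent of `p`, that is
`p / (p - 1)`, read as `∞` for `p = 1` and as `1` for `p = ∞`. -/
structure DualFeasible (β : (t : Fin T) → Fin (D.N t) → ℝ) (lam : Fin T → ℝ) : Prop where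
  balance : ∀ t, β t ⬝ᵥ D.y t = 0
  nonneg : ∀ t i, 0 ≤ β t i
  le : ∀ t i, β t i ≤ lam t * C
  ball : lam ∈ posBall T (ENNReal.conjExponent p)

/-- The values of `Φ(θ, ·, ·)` at the feasible `(β, λ)`. -/
def dualValuesAt (θ : Fin M → ℝ) : Set ℝ :=
  {r | ∃ β lam, DualFeasible D C p β lam ∧ r = Phi D H θ β lam}

/-- `max_{λ, β} Φ(θ, β, λ)` over the feasible `(β, λ)`. -/
def innerMax (θ : Fin M → ℝ) : ℝ := sSup (dualValuesAt D C p H θ)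

/-- `(θ, β, λ)` is a solution of the min-max problem: `(β, λ)` attains the inner maximum at `θ`,
and `θ` minimizes the inner maximum over the ball. -/
def IsMinMaxSolution (θ : Fin M → ℝ) (β : (t : Fin T) → Fin (D.N t) → ℝ)
    (lam : Fin T → ℝ) : Prop :=
  θ ∈ posBall M s ∧ DualFeasible D C p β lam ∧
    (∀ β' lam', DualFeasible D C p β' lam' → Phi D H θ β' lam' ≤ Phi D H θ β lam) ∧
    ∀ θ' ∈ posBall M s, innerMax D C p H θ ≤ innerMax D C p H θ'

end Problem

end MTMKL

end

/-! Fix `θ`. The tasks interact only through the outer norm, so each can be minimized separately,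
and since the `ℓ_p` norm is monotone on nonnegative vectors (`nu_mono`), the separate minimizers
jointly minimize it. Each task is a multi-kernel SVM with strong duality
(`exists_svm_strong_duality`): first-order conditions at a dual maximizer produce a primal point of
equal value.

By norm duality (`isGreatest_sum_mul`) the norm of the vector of optima is the maximum of its
pairing with `λ` in the `ℓ_q` ball, and `βᵗ = λᵗ αᵗ` turns the weighted sum of SVM duals into `Φ`
(`Phi_smul`). No minimax theorem is needed.

Both problems thus minimize the same function of `θ`, namely `innerMax`. It is lower semicontinuous
and the ball is compact, so a minimizer exists. -/

namespace MTMKL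

/-! ### Norms and their duality on nonnegative vectors -/

theorem nu_top {n : ℕ} (v : Fin n → ℝ) : nu ∞ v = ⨆ i, |v i| := by
  simp [nu, PiLp.norm_eq_ciSup]

theorem nu_one {n : ℕ} (v : Fin n → ℝ) : nu 1 v = ∑ i, |v i| := by
  simp [nu, PiLp.norm_eq_of_L1]

theorem nu_eq_sum {n : ℕ} {p : ℝ≥0∞} (hp : 0 < p.toReal) (v : Fin n → ℝ) :
    nu p v = (∑ i, |v i| ^ p.toReal) ^ (1 / p.toReal) := by
  simp [nu, PiLp.norm_eq_sum hp]

theorem nu_zero {n : ℕ} {p : ℝ≥0∞} (hp : 1 ≤ p) : nu p (0 : Fin n → ℝ) = 0 := by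
  have : Fact (1 ≤ p) := ⟨hp⟩
  simp [nu]

theorem zero_mem_posBall {n : ℕ} {p : ℝ≥0∞} (hp : 1 ≤ p) : (0 : Fin n → ℝ) ∈ posBall n p :=
  ⟨fun _ => le_rfl, by rw [nu_zero hp]; exact zero_le_one⟩

theorem isCompact_posBall {n : ℕ} {p : ℝ≥0∞} (hp : 1 ≤ p) : IsCompact (posBall n p) := by
  have : Fact (1 ≤ p) := ⟨hp⟩
  have hball : IsCompact {v : Fin n → ℝ | nu p v ≤ 1} := by
    have h := (isCompact_closedBall (0 : PiLp p (fun _ : Fin n => ℝ)) 1).image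
      (PiLp.continuous_ofLp p (fun _ : Fin n => ℝ))
    convert h using 1
    ext v
    constructor
    · intro hv
      exact ⟨WithLp.toLp p v, by simpa [nu] using hv, rfl⟩
    · rintro ⟨w, hw, rfl⟩
      simpa [nu] using hw
  have hclosed : IsClosed {v : Fin n → ℝ | ∀ i, 0 ≤ v i} := by
    simp only [Set.ofPred_forall]
    exact isClosed_iInter fun i => isClosed_le continuous_const (continuous_apply i)
  exact hball.inter_left hclosed

theorem isGreatest_sum_mul_of_holderConjugate {n : ℕ} {p q : ℝ≥0∞}
    (hpq : p.toReal.HolderConjugate q.toReal) {g : Fin n → ℝ}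
    (hg : ∀ i, 0 ≤ g i) :
    IsGreatest {r | ∃ lam ∈ posBall n q, r = ∑ i, lam i * g i} (nu p g) := by
  have hp := hpq.pos
  have hq := hpq.symm.pos
  have key := NNReal.isGreatest_Lp Finset.univ (fun i => (g i).toNNReal) hpq
  have hval : nu p g =
      (((∑ i, (g i).toNNReal ^ p.toReal) ^ (1 / p.toReal) : NNReal) : ℝ) := by
    rw [nu_eq_sum hp]
    push_cast
    simp [abs_of_nonneg, hg]
  -- `NNReal.isGreatest_Lp` describes the ball by the sum of powers, without the root.
  have hball : ∀ v : Fin n → NNReal, ∑ i, v i ^ q.toReal ≤ 1 ↔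
      (fun i => (v i : ℝ)) ∈ posBall n q := by
    intro v
    have h1 : nu q (fun i => (v i : ℝ)) =
        (((∑ i, v i ^ q.toReal) ^ (1 / q.toReal) : NNReal) : ℝ) := by
      rw [nu_eq_sum hq]
      push_cast
      simp
    have h2 : (∑ i, v i ^ q.toReal) ^ (1 / q.toReal) ≤ 1 ↔ ∑ i, v i ^ q.toReal ≤ 1 := by
      conv_lhs => rw [← NNReal.one_rpow (1 / q.toReal)]
      exact NNReal.rpow_le_rpow_iff (by positivity)
    rw [← h2]
    simp only [posBall, Set.mem_ofPred_eq, h1]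
    constructor
    · intro h
      exact ⟨fun i => NNReal.coe_nonneg _, by exact_mod_cast h⟩
    · intro h
      exact_mod_cast h.2
  rw [hval]
  constructor
  · obtain ⟨v, hv, hsum⟩ := key.1
    refine ⟨fun i => v i, (hball v).1 hv, ?_⟩
    rw [← hsum]
    push_cast
    exact Finset.sum_congr rfl fun i _ => by rw [Real.coe_toNNReal _ (hg i), mul_comm]
  · rintro r ⟨lam, hlam, rfl⟩
    have hl : (fun i => ((lam i).toNNReal : ℝ)) = lam :=
      funext fun i => Real.coe_toNNReal _ (hlam.1 i)
    have h := key.2 ⟨fun i => (lam i).toNNReal, (hball _).2 (by rwa [hl]), rfl⟩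
    refine le_trans (le_of_eq ?_) (NNReal.coe_le_coe.2 h)
    push_cast
    exact Finset.sum_congr rfl fun i _ => by
      rw [Real.coe_toNNReal _ (hg i), Real.coe_toNNReal _ (hlam.1 i), mul_comm]

theorem isGreatest_sum_mul_one {n : ℕ} {g : Fin n → ℝ} (hg : ∀ i, 0 ≤ g i) :
    IsGreatest {r | ∃ lam ∈ posBall n ∞, r = ∑ i, lam i * g i} (nu 1 g) := by
  have hval : nu 1 g = ∑ i, g i := by
    rw [nu_one]
    exact Finset.sum_congr rfl fun i _ => abs_of_nonneg (hg i)
  rw [hval]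
  constructor
  · refine ⟨fun _ => 1, ⟨fun _ => zero_le_one, ?_⟩, by simp⟩
    rw [nu_top]
    exact Real.iSup_le (fun i => by simp) zero_le_one
  · rintro r ⟨lam, hlam, rfl⟩
    refine Finset.sum_le_sum fun i _ => mul_le_of_le_one_left (hg i) ?_
    have h := hlam.2
    rw [nu_top] at h
    exact (le_abs_self _).trans ((le_ciSup (Set.finite_range fun i => |lam i|).bddAbove i).trans h)

theorem isGreatest_sum_mul_top {n : ℕ} {g : Fin n → ℝ} (hg : ∀ i, 0 ≤ g i) :
    IsGreatest {r | ∃ lam ∈ posBall n 1, r = ∑ i, lam i * g i} (nu ∞ g) := by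
  have hbdd : BddAbove (Set.range g) := (Set.finite_range g).bddAbove
  have hval : nu ∞ g = ⨆ i, g i := by
    rw [nu_top]
    exact congrArg iSup (funext fun i => abs_of_nonneg (hg i))
  rw [hval]
  constructor
  · rcases isEmpty_or_nonempty (Fin n) with hn | hn
    · exact ⟨0, zero_mem_posBall le_rfl, by simp⟩
    · obtain ⟨i, hi⟩ := exists_eq_ciSup_of_finite (f := g)
      refine ⟨Pi.single i 1, ⟨fun j => ?_, ?_⟩, ?_⟩
      · by_cases h : j = i
        · subst h; simp
        · simp [h]
      · rw [nu_one, Finset.sum_eq_single i (fun j _ h => by simp [h]) (by simp)]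
        simp
      · rw [Finset.sum_eq_single i (fun j _ h => by simp [h]) (by simp)]
        simp [hi]
  · rintro r ⟨lam, hlam, rfl⟩
    have h := hlam.2
    rw [nu_one, Finset.sum_congr rfl fun i _ => abs_of_nonneg (hlam.1 i)] at h
    calc ∑ i, lam i * g i ≤ ∑ i, lam i * ⨆ j, g j :=
          Finset.sum_le_sum fun i _ => mul_le_mul_of_nonneg_left (le_ciSup hbdd i) (hlam.1 i)
      _ = (∑ i, lam i) * ⨆ j, g j := by rw [Finset.sum_mul]
      _ ≤ ⨆ j, g j := mul_le_of_le_one_left (Real.iSup_nonneg hg) h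

/-- Duality of the `ℓ_p` and `ℓ_q` norms on nonnegative vectors. -/
theorem isGreatest_sum_mul {n : ℕ} {p : ℝ≥0∞} (hp : 1 ≤ p) {g : Fin n → ℝ}
    (hg : ∀ i, 0 ≤ g i) :
    IsGreatest {r | ∃ lam ∈ posBall n (ENNReal.conjExponent p), r = ∑ i, lam i * g i}
      (nu p g) := by
  rcases eq_or_ne p ∞ with rfl | htop
  · simpa [ENNReal.conjExponent] using isGreatest_sum_mul_top hg
  rcases eq_or_lt_of_le hp with rfl | hlt
  · simpa [ENNReal.conjExponent] using isGreatest_sum_mul_one hg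
  lift p to NNReal using htop
  have hlt' : 1 < p := by exact_mod_cast hlt
  have hpq : (p : ℝ).HolderConjugate (NNReal.conjExponent p : ℝ) :=
    (NNReal.HolderConjugate.conjExponent hlt').coe
  rw [← ENNReal.coe_conjExponent hlt']
  exact isGreatest_sum_mul_of_holderConjugate (p := p) (q := NNReal.conjExponent p) hpq hg

/-- A `lam` that is optimal for `v` pairs at least as well with `w`. -/
theorem nu_mono {n : ℕ} {p : ℝ≥0∞} (hp : 1 ≤ p) {v w : Fin n → ℝ} (hv : ∀ i, 0 ≤ v i)
    (hvw : ∀ i, v i ≤ w i) : nu p v ≤ nu p w := by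
  obtain ⟨lam, hlam, h⟩ := (isGreatest_sum_mul hp hv).1
  rw [h]
  exact (Finset.sum_le_sum fun i _ => mul_le_mul_of_nonneg_left (hvw i) (hlam.1 i)).trans
    ((isGreatest_sum_mul hp fun i => (hv i).trans (hvw i)).2 ⟨lam, hlam, rfl⟩)

/-- Supplies the bias of the SVM: its bounds from below and above come from two families of samples,
either of which may be empty. -/
theorem exists_between_of_forall_le {ι : Type*} [Finite ι] (P Q : ι → Prop) (G : ι → ℝ)
    (h : ∀ i j, P i → Q j → G i ≤ G j) :
    ∃ b, (∀ i, P i → G i ≤ b) ∧ ∀ j, Q j → b ≤ G j := by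
  have hfin : (G '' {i | P i}).Finite := Set.toFinite _
  by_cases hP : ∃ i, P i
  · obtain ⟨i, hi⟩ := hP
    refine ⟨sSup (G '' {i | P i}), fun k hk => le_csSup hfin.bddAbove ⟨k, hk, rfl⟩,
      fun j hj => csSup_le ⟨_, i, hi, rfl⟩ ?_⟩
    rintro _ ⟨k, hk, rfl⟩
    exact h k j hk hj
  · obtain ⟨b, hb⟩ := (Set.finite_range G).bddBelow
    exact ⟨b, fun i hi => (hP ⟨i, hi⟩).elim, fun j _ => hb ⟨j, rfl⟩⟩

/-! ### Strong duality for a single multi-kernel SVM -/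

section SVM

variable {n M : ℕ} {H : Fin M → Type*} [∀ m, NormedAddCommGroup (H m)]
  [∀ m, InnerProductSpace ℝ (H m)]

/-- Dual objective of a single multi-kernel SVM with feature vectors `e m i` and labels `y`. -/
noncomputable def svmDual (e : (m : Fin M) → Fin n → H m) (y : Fin n → ℝ) (θ : Fin M → ℝ)
    (α : Fin n → ℝ) : ℝ :=
  ∑ i, α i - 1 / 2 * ∑ m, θ m * ‖∑ i, (α i * y i) • e m i‖ ^ 2

/-- The feasible set of the dual of a single SVM. -/
def svmBox (C : ℝ) (y : Fin n → ℝ) : Set (Fin n → ℝ) :=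
  {α | (∀ i, 0 ≤ α i) ∧ (∀ i, α i ≤ C) ∧ ∑ i, α i * y i = 0}

theorem continuous_svmDual (e : (m : Fin M) → Fin n → H m) (y : Fin n → ℝ) (θ : Fin M → ℝ) :
    Continuous (svmDual e y θ) := by
  unfold svmDual
  fun_prop

theorem isCompact_svmBox (C : ℝ) (y : Fin n → ℝ) : IsCompact (svmBox C y) := by
  have h : svmBox C y = Set.Icc 0 (fun _ => C) ∩ {α | ∑ i, α i * y i = 0} := by
    ext α
    simp [svmBox, Pi.le_def, and_assoc]
  rw [h]
  exact isCompact_Icc.inter_right (isClosed_eq (by fun_prop) continuous_const)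

/-- The dual objective is quadratic, so this expansion is exact and replaces differentiation. -/
theorem svmDual_add_smul (e : (m : Fin M) → Fin n → H m) (y : Fin n → ℝ) (θ : Fin M → ℝ)
    (α d : Fin n → ℝ) (ε : ℝ) :
    svmDual e y θ (α + ε • d) = svmDual e y θ α
      + ε * (∑ i, d i - ∑ m, θ m *
          inner ℝ (∑ i, (α i * y i) • e m i) (∑ i, (d i * y i) • e m i))
      - ε ^ 2 * (1 / 2 * ∑ m, θ m * ‖∑ i, (d i * y i) • e m i‖ ^ 2) := by
  have h1 : ∀ m, ∑ i, ((α + ε • d) i * y i) • e m i =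
      ∑ i, (α i * y i) • e m i + ε • ∑ i, (d i * y i) • e m i := fun m => by
    rw [Finset.smul_sum, ← Finset.sum_add_distrib]
    refine Finset.sum_congr rfl fun i _ => ?_
    rw [smul_smul, ← add_smul]
    congr 1
    simp only [Pi.add_apply, Pi.smul_apply, smul_eq_mul]
    ring
  have h2 : ∑ m, θ m * ‖∑ i, ((α + ε • d) i * y i) • e m i‖ ^ 2 =
      ∑ m, θ m * ‖∑ i, (α i * y i) • e m i‖ ^ 2
      + 2 * ε * ∑ m, θ m * inner ℝ (∑ i, (α i * y i) • e m i) (∑ i, (d i * y i) • e m i)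
      + ε ^ 2 * ∑ m, θ m * ‖∑ i, (d i * y i) • e m i‖ ^ 2 := by
    rw [Finset.mul_sum, Finset.mul_sum, ← Finset.sum_add_distrib, ← Finset.sum_add_distrib]
    refine Finset.sum_congr rfl fun m _ => ?_
    rw [h1, norm_add_sq_real, real_inner_smul_right, norm_smul, mul_pow, Real.norm_eq_abs, sq_abs]
    ring
  unfold svmDual
  rw [h2]
  simp only [Pi.add_apply, Pi.smul_apply, smul_eq_mul, Finset.sum_add_distrib, ← Finset.mul_sum]
  ring

theorem mul_le_quadratic_div {a h θ : ℝ} (hθ : 0 < θ) : a * h ≤ a ^ 2 / (2 * θ) + θ / 2 * h ^ 2 := by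
  have h0 : a ^ 2 / (2 * θ) + θ / 2 * h ^ 2 - a * h = (a - θ * h) ^ 2 / (2 * θ) := by
    field_simp
    ring
  have : 0 ≤ (a - θ * h) ^ 2 / (2 * θ) := by positivity
  linarith

/-- Weak duality: weight the margin constraints by `α`. The bias drops out by the balance condition,
and Young's inequality bounds each kernel term. -/
theorem svmDual_le (e : (m : Fin M) → Fin n → H m) {y : Fin n → ℝ} {θ : Fin M → ℝ} {C : ℝ}
    (hθ : ∀ m, 0 ≤ θ m) {α : Fin n → ℝ} (hα : α ∈ svmBox C y) {f : (m : Fin M) → H m}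
    {ξ : Fin n → ℝ} {b : ℝ} (hmargin : ∀ i, y i * (∑ m, inner ℝ (f m) (e m i) + b) ≥ 1 - ξ i)
    (hξ : ∀ i, 0 ≤ ξ i) (hf : ∀ m, θ m = 0 → f m = 0) :
    svmDual e y θ α ≤ ∑ m, ‖f m‖ ^ 2 / (2 * θ m) + C * ∑ i, ξ i := by
  obtain ⟨h0, hC, hbal⟩ := hα
  have h1 : ∑ i, α i ≤ ∑ i, (C * ξ i + α i * y i * ∑ m, inner ℝ (f m) (e m i)
      + b * (α i * y i)) := by
    refine Finset.sum_le_sum fun i _ => ?_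
    have h2 := mul_le_mul_of_nonneg_left (hmargin i) (h0 i)
    have h3 := mul_le_mul_of_nonneg_right (hC i) (hξ i)
    linarith
  rw [Finset.sum_add_distrib, Finset.sum_add_distrib, ← Finset.mul_sum, ← Finset.mul_sum, hbal,
    mul_zero, add_zero] at h1
  have h4 : ∑ i, α i * y i * ∑ m, inner ℝ (f m) (e m i) =
      ∑ m, inner ℝ (f m) (∑ i, (α i * y i) • e m i) := by
    simp only [Finset.mul_sum, inner_sum, real_inner_smul_right]
    exact Finset.sum_comm
  have h5 : ∑ m, inner ℝ (f m) (∑ i, (α i * y i) • e m i) ≤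
      ∑ m, (‖f m‖ ^ 2 / (2 * θ m) + 1 / 2 * (θ m * ‖∑ i, (α i * y i) • e m i‖ ^ 2)) := by
    refine Finset.sum_le_sum fun m _ => ?_
    rcases (hθ m).eq_or_lt with h | h
    · simp [hf m h.symm, ← h]
    · have := (real_inner_le_norm (f m) _).trans
        (mul_le_quadratic_div (a := ‖f m‖) (h := ‖∑ i, (α i * y i) • e m i‖) h)
      linarith
  rw [Finset.sum_add_distrib, ← Finset.mul_sum] at h5
  unfold svmDual
  linarith

theorem nonpos_of_forall_mul_le {L A δ : ℝ} (hδ : 0 < δ)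
    (h : ∀ ε, 0 < ε → ε ≤ δ → ε * L - ε ^ 2 * A ≤ 0) : L ≤ 0 := by
  by_contra! hL
  -- Small enough that `ε * |A| < L / 2`, so the linear term dominates.
  set ε := min δ (L / (2 * (|A| + 1)))
  have hA : 0 < 2 * (|A| + 1) := by positivity
  have hε : 0 < ε := lt_min hδ (by positivity)
  have h1 := h ε hε (min_le_left _ _)
  have h2 : ε * (2 * (|A| + 1)) ≤ L := (le_div_iff₀ hA).1 (min_le_right _ _)
  have h3 : L - ε * A ≤ 0 := by
    by_contra! h4
    nlinarith [mul_pos hε h4]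
  have h4 : ε * A ≤ ε * |A| := mul_le_mul_of_nonneg_left (le_abs_self A) hε.le
  linarith

/-- First-order optimality of a maximizer of the dual objective along the direction that moves
weight from the sample `j` to the sample `i`. -/
theorem svmDual_gradient_le (e : (m : Fin M) → Fin n → H m) {y : Fin n → ℝ} {θ : Fin M → ℝ}
    {C : ℝ} (hy : ∀ i, y i * y i = 1) {α : Fin n → ℝ} (hα : α ∈ svmBox C y)
    (hmax : ∀ α' ∈ svmBox C y, svmDual e y θ α' ≤ svmDual e y θ α) {i j : Fin n} {δ δ' : ℝ}
    (hδ : 0 < δ) (hi : 0 ≤ α i + δ * y i ∧ α i + δ * y i ≤ C)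
    (hδ' : 0 < δ') (hj : 0 ≤ α j - δ' * y j ∧ α j - δ' * y j ≤ C) :
    y i - ∑ m, θ m * inner ℝ (∑ k, (α k * y k) • e m k) (e m i) ≤
      y j - ∑ m, θ m * inner ℝ (∑ k, (α k * y k) • e m k) (e m j) := by
  rcases eq_or_ne i j with rfl | hij
  · exact le_rfl
  -- As `y k * y k = 1`, this direction preserves `∑ k, α k * y k` and shifts each feature sum along
  -- `e m i - e m j`.
  set d : Fin n → ℝ := Pi.single i (y i) - Pi.single j (y j) with hd
  have hdi : d i = y i := by simp [hd, hij]
  have hdj : d j = -y j := by simp [hd, hij.symm]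
  have hdk : ∀ k, k ≠ i → k ≠ j → d k = 0 := fun k h1 h2 => by simp [hd, h1, h2]
  have hdsum : ∀ m, ∑ k, (d k * y k) • e m k = e m i - e m j := by
    intro m
    rw [Finset.sum_eq_add i j hij (fun k _ h => by simp [hdk k h.1 h.2]) (by simp) (by simp),
      hdi, hdj, neg_mul, hy, hy, one_smul, neg_one_smul, sub_eq_add_neg]
  have hmem : ∀ ε, 0 < ε → ε ≤ min δ δ' → α + ε • d ∈ svmBox C y := by
    intro ε hε hεδ
    have hε1 := hεδ.trans (min_le_left _ _)
    have hε2 := hεδ.trans (min_le_right _ _)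
    have hpt : ∀ k, 0 ≤ (α + ε • d) k ∧ (α + ε • d) k ≤ C := by
      intro k
      have h0 := hα.1 k
      have hC := hα.2.1 k
      simp only [Pi.add_apply, Pi.smul_apply, smul_eq_mul]
      by_cases h1 : k = i
      · subst h1
        rw [hdi]
        rcases le_total 0 (y k) with h | h
        · have := mul_le_mul_of_nonneg_right hε1 h
          have := mul_nonneg hε.le h
          constructor <;> linarith
        · have := mul_le_mul_of_nonpos_right hε1 h
          have := mul_nonpos_of_nonneg_of_nonpos hε.le h
          constructor <;> linarith
      by_cases h2 : k = j
      · subst h2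
        rw [hdj]
        rcases le_total 0 (y k) with h | h
        · have := mul_le_mul_of_nonneg_right hε2 h
          have := mul_nonneg hε.le h
          constructor <;> linarith
        · have := mul_le_mul_of_nonpos_right hε2 h
          have := mul_nonpos_of_nonneg_of_nonpos hε.le h
          constructor <;> linarith
      rw [hdk k h1 h2]
      constructor <;> linarith
    refine ⟨fun k => (hpt k).1, fun k => (hpt k).2, ?_⟩
    have h1 : ∑ k, d k * y k = 0 := by
      rw [Finset.sum_eq_add i j hij (fun k _ h => by simp [hdk k h.1 h.2]) (by simp) (by simp),
        hdi, hdj, neg_mul, hy, hy, add_neg_cancel]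
    simp only [Pi.add_apply, Pi.smul_apply, smul_eq_mul, add_mul, Finset.sum_add_distrib, hα.2.2,
      mul_assoc, ← Finset.mul_sum, h1, mul_zero, add_zero]
  have hL := nonpos_of_forall_mul_le
    (L := ∑ i, d i - ∑ m, θ m *
      inner ℝ (∑ i, (α i * y i) • e m i) (∑ i, (d i * y i) • e m i))
    (A := 1 / 2 * ∑ m, θ m * ‖∑ i, (d i * y i) • e m i‖ ^ 2) (lt_min hδ hδ') fun ε hε hεδ => by
    have h1 := hmax _ (hmem ε hε hεδ)
    rw [svmDual_add_smul] at h1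
    linarith
  have hd1 : ∑ k, d k = y i - y j := by
    rw [Finset.sum_eq_add i j hij (fun k _ h => hdk k h.1 h.2) (by simp) (by simp), hdi, hdj,
      sub_eq_add_neg]
  simp only [hd1, hdsum, inner_sub_right, mul_sub, Finset.sum_sub_distrib] at hL
  linarith

/-- Strong duality for a single multi-kernel SVM, with attainment on both sides. -/
theorem exists_svm_strong_duality (e : (m : Fin M) → Fin n → H m) {y : Fin n → ℝ}
    {θ : Fin M → ℝ} {C : ℝ} (hC : 0 ≤ C) (hy : ∀ i, y i = 1 ∨ y i = -1) :
    ∃ α ∈ svmBox C y, ∃ (f : (m : Fin M) → H m) (ξ : Fin n → ℝ) (b : ℝ),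
      (∀ i, y i * (∑ m, inner ℝ (f m) (e m i) + b) ≥ 1 - ξ i) ∧ (∀ i, 0 ≤ ξ i) ∧
      (∀ m, θ m = 0 → f m = 0) ∧
      ∑ m, ‖f m‖ ^ 2 / (2 * θ m) + C * ∑ i, ξ i = svmDual e y θ α := by
  have hy2 : ∀ i, y i * y i = 1 := fun i => by rcases hy i with h | h <;> rw [h] <;> norm_num
  obtain ⟨α, hα, hmax⟩ := (isCompact_svmBox C y).exists_isMaxOn
    ⟨0, fun _ => le_rfl, fun _ => hC, by simp⟩ (continuous_svmDual e y θ).continuousOn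
  refine ⟨α, hα, ?_⟩
  set h : (m : Fin M) → H m := fun m => ∑ k, (α k * y k) • e m k with hh
  set F : Fin n → ℝ := fun i => ∑ m, θ m * inner ℝ (h m) (e m i) with hF
  -- The samples whose signed weight `α i * y i` can increase bound `b` from below, those whose
  -- signed weight can decrease bound it from above.
  obtain ⟨b, hb1, hb2⟩ := exists_between_of_forall_le
    (fun i => ∃ δ, 0 < δ ∧ 0 ≤ α i + δ * y i ∧ α i + δ * y i ≤ C)
    (fun i => ∃ δ, 0 < δ ∧ 0 ≤ α i - δ * y i ∧ α i - δ * y i ≤ C) (fun i => y i - F i) (by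
      rintro i j ⟨δ, hδ, hi⟩ ⟨δ', hδ', hj⟩
      exact svmDual_gradient_le e hy2 hα (fun α' h => hmax h) hδ hi hδ' hj)
  set u : Fin n → ℝ := fun i => 1 - y i * (F i + b) with hu
  have hlt : ∀ i, α i < C → u i ≤ 0 := by
    intro i hi
    have h0 := hα.1 i
    rcases hy i with h | h
    · have := hb1 i ⟨C - α i, by linarith, by rw [h]; constructor <;> linarith⟩
      simp only [hu, h] at this ⊢
      linarith
    · have := hb2 i ⟨C - α i, by linarith, by rw [h]; constructor <;> linarith⟩
      simp only [hu, h] at this ⊢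
      linarith
  have hpos : ∀ i, 0 < α i → 0 ≤ u i := by
    intro i hi
    have h0 := hα.2.1 i
    rcases hy i with h | h
    · have := hb2 i ⟨α i, hi, by rw [h]; constructor <;> linarith⟩
      simp only [hu, h] at this ⊢
      linarith
    · have := hb1 i ⟨α i, hi, by rw [h]; constructor <;> linarith⟩
      simp only [hu, h] at this ⊢
      linarith
  -- Complementary slackness, with `max 0 (u i)` as the slack variable.
  have hslack : ∀ i, C * max 0 (u i) = α i * u i := by
    intro i
    rcases (hα.1 i).eq_or_lt with h0 | h0
    -- For `C = 0` the bound `hlt` is unavailable, but both sides vanish.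
    · rcases hC.eq_or_lt with h1 | h1
      · rw [← h0, ← h1]; simp
      · rw [max_eq_left (hlt i (h0 ▸ h1)), ← h0]; simp
    · rw [max_eq_right (hpos i h0)]
      rcases (hα.2.1 i).eq_or_lt with h1 | h1
      · rw [h1]
      · rw [le_antisymm (hlt i h1) (hpos i h0)]; simp
  -- `θ m • h m` is the equality case of the Young inequality used in `svmDual_le`.
  refine ⟨fun m => θ m • h m, fun i => max 0 (u i), b, ?_, fun i => le_max_left _ _,
    fun m hm => by simp [hm], ?_⟩
  · intro i
    simp only [real_inner_smul_left]
    have := le_max_right 0 (u i)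
    simp only [hu, hF] at this ⊢
    linarith
  · have hnorm : ∑ m, ‖θ m • h m‖ ^ 2 / (2 * θ m) = 1 / 2 * ∑ m, θ m * ‖h m‖ ^ 2 := by
      rw [Finset.mul_sum]
      refine Finset.sum_congr rfl fun m _ => ?_
      rw [norm_smul, mul_pow, Real.norm_eq_abs, sq_abs]
      rcases eq_or_ne (θ m) 0 with h0 | h0
      · simp [h0]
      · field_simp
    have hcross : ∑ i, α i * y i * F i = ∑ m, θ m * ‖h m‖ ^ 2 := by
      simp only [hF, Finset.mul_sum]
      rw [Finset.sum_comm]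
      refine Finset.sum_congr rfl fun m _ => ?_
      rw [← real_inner_self_eq_norm_sq]
      conv_rhs => rw [hh]
      simp only [inner_sum, real_inner_smul_right, Finset.mul_sum]
      exact Finset.sum_congr rfl fun i _ => by ring
    have hsum : C * ∑ i, max 0 (u i) = ∑ i, α i - ∑ i, α i * y i * F i := by
      rw [Finset.mul_sum, Finset.sum_congr rfl fun i _ => hslack i]
      have : ∀ i, α i * u i = α i - α i * y i * F i - b * (α i * y i) := fun i => by
        simp only [hu]; ring
      simp only [this, Finset.sum_sub_distrib, ← Finset.mul_sum, hα.2.2, mul_zero, sub_zero]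
    rw [hnorm, hsum, hcross]
    unfold svmDual
    ring

end SVM
-- Coupling the tasks through the outer norm
section MultiTask

variable {X : Type*} {T M : ℕ} {D : TrainingData X T} {C : ℝ} {p s : ℝ≥0∞}
  {H : Fin M → Type*} [∀ m, NormedAddCommGroup (H m)] [∀ m, InnerProductSpace ℝ (H m)]
  [∀ m, CompleteSpace (H m)] [∀ m, RKHS ℝ (H m) X ℝ]

variable (D H) in
/-- The representer of evaluation at the `i`-th sample of task `t` in `H m`. -/
noncomputable def feature (t : Fin T) (m : Fin M) (i : Fin (D.N t)) : H m :=
  RKHS.kerFun (H m) (D.x t i) (1 : ℝ)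

theorem inner_feature (t : Fin T) (m : Fin M) (i : Fin (D.N t)) (f : H m) :
    inner ℝ f (feature D H t m i) = f (D.x t i) := by
  simp [feature]

theorem kernelMatrix_apply (m : Fin M) (t : Fin T) (i j : Fin (D.N t)) :
    kernelMatrix D H m t i j = inner ℝ (feature D H t m i) (feature D H t m j) := by
  have h := RKHS.kerFun_apply (H m) (D.x t j) (1 : ℝ) (D.x t i)
  rw [real_inner_comm, inner_feature]
  exact h.symm

theorem quadratic_form_eq (θ : Fin M → ℝ) (t : Fin T) (β : Fin (D.N t) → ℝ) :
    β ⬝ᵥ (((labelMatrix D t)ᵀ * (∑ m, θ m • kernelMatrix D H m t) * labelMatrix D t) *ᵥ β) =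
      ∑ m, θ m * ‖∑ i, (β i * D.y t i) • feature D H t m i‖ ^ 2 := by
  have h1 : ∀ m, ‖∑ i, (β i * D.y t i) • feature D H t m i‖ ^ 2 =
      ∑ i, ∑ j, β i * D.y t i * (β j * D.y t j * kernelMatrix D H m t i j) := by
    intro m
    rw [← real_inner_self_eq_norm_sq, sum_inner]
    refine Finset.sum_congr rfl fun i _ => ?_
    rw [inner_sum]
    refine Finset.sum_congr rfl fun j _ => ?_
    rw [real_inner_smul_left, real_inner_smul_right, kernelMatrix_apply]
  simp only [h1, labelMatrix, Matrix.diagonal_transpose, dotProduct, Matrix.mulVec,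
    Matrix.mul_diagonal, Matrix.diagonal_mul, Matrix.sum_apply, Matrix.smul_apply, smul_eq_mul,
    Finset.mul_sum, Finset.sum_mul]
  rw [Finset.sum_comm' (t' := Finset.univ) (s' := fun _ => Finset.univ) (by simp)]
  conv_rhs => rw [Finset.sum_comm]
  conv_lhs => rw [Finset.sum_comm]
  refine Finset.sum_congr rfl fun i _ => ?_
  rw [Finset.sum_comm]
  refine Finset.sum_congr rfl fun m _ => Finset.sum_congr rfl fun j _ => ?_
  ring

/-- The quadratic form scales by `lam t ^ 2`, and the factor `1 / lam t` in `Phi` leaves one power;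
for `lam t = 0` both summands vanish. -/
theorem Phi_smul (θ : Fin M → ℝ) (α : (t : Fin T) → Fin (D.N t) → ℝ) (lam : Fin T → ℝ) :
    Phi D H θ (fun t => lam t • α t) lam =
      ∑ t, lam t * svmDual (feature D H t) (D.y t) θ (α t) := by
  refine Finset.sum_congr rfl fun t _ => ?_
  rw [quadratic_form_eq]
  have h1 : ∀ m, ∑ i, ((lam t • α t) i * D.y t i) • feature D H t m i =
      lam t • ∑ i, (α t i * D.y t i) • feature D H t m i := fun m => by
    rw [Finset.smul_sum]
    refine Finset.sum_congr rfl fun i _ => ?_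
    rw [smul_smul, Pi.smul_apply, smul_eq_mul, mul_assoc]
  have h2 : ∑ m, θ m * ‖∑ i, ((lam t • α t) i * D.y t i) • feature D H t m i‖ ^ 2 =
      lam t ^ 2 * ∑ m, θ m * ‖∑ i, (α t i * D.y t i) • feature D H t m i‖ ^ 2 := by
    rw [Finset.mul_sum]
    refine Finset.sum_congr rfl fun m _ => ?_
    rw [h1, norm_smul, mul_pow, Real.norm_eq_abs, sq_abs]
    ring
  rw [h2]
  simp only [svmDual, dotProduct, Pi.smul_apply, smul_eq_mul, mul_one, ← Finset.mul_sum]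
  rcases eq_or_ne (lam t) 0 with h | h
  · simp [h]
  · field_simp

theorem DualFeasible.exists_eq_smul {β : (t : Fin T) → Fin (D.N t) → ℝ} {lam : Fin T → ℝ}
    (hC : 0 ≤ C) (h : DualFeasible D C p β lam) :
    ∃ α : (t : Fin T) → Fin (D.N t) → ℝ,
      (∀ t, α t ∈ svmBox C (D.y t)) ∧ β = fun t => lam t • α t := by
  have key : ∀ t, ∃ α ∈ svmBox C (D.y t), β t = lam t • α := by
    intro t
    rcases (h.ball.1 t).eq_or_lt with h0 | h0
    -- For `lam t = 0` the constraints force `β t = 0`, so any point of the box serves.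
    · refine ⟨0, ⟨fun _ => le_rfl, fun _ => hC, by simp⟩, funext fun i => ?_⟩
      have h1 := h.le t i
      rw [← h0, zero_mul] at h1
      simpa using le_antisymm h1 (h.nonneg t i)
    · refine ⟨(lam t)⁻¹ • β t, ⟨fun i => ?_, fun i => ?_, ?_⟩, ?_⟩
      · exact mul_nonneg (inv_nonneg.2 h0.le) (h.nonneg t i)
      · simp only [Pi.smul_apply, smul_eq_mul]
        rw [inv_mul_le_iff₀ h0]
        exact h.le t i
      · have h1 := h.balance t
        simp only [dotProduct] at h1
        simp only [Pi.smul_apply, smul_eq_mul, mul_assoc, ← Finset.mul_sum, h1, mul_zero]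
      · rw [smul_inv_smul₀ h0.ne']
  choose α hα hβ using key
  exact ⟨α, hα, funext hβ⟩

theorem dualFeasible_smul {α : (t : Fin T) → Fin (D.N t) → ℝ} {lam : Fin T → ℝ}
    (hα : ∀ t, α t ∈ svmBox C (D.y t)) (hlam : lam ∈ posBall T (ENNReal.conjExponent p)) :
    DualFeasible D C p (fun t => lam t • α t) lam where
  balance t := by rw [smul_dotProduct, dotProduct, (hα t).2.2, smul_zero]
  nonneg t i := mul_nonneg (hlam.1 t) ((hα t).1 i)
  le t i := mul_le_mul_of_nonneg_left ((hα t).2.1 i) (hlam.1 t)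
  ball := hlam

theorem svmDual_le_svmObjective {f : (t : Fin T) → (m : Fin M) → H m} {θ : Fin M → ℝ}
    {ξ : (t : Fin T) → Fin (D.N t) → ℝ} {b : Fin T → ℝ} (h : PrimalFeasible D s H f θ ξ b)
    (t : Fin T) {α : Fin (D.N t) → ℝ} (hα : α ∈ svmBox C (D.y t)) :
    svmDual (feature D H t) (D.y t) θ α ≤ svmObjective D C H f θ ξ t := by
  refine svmDual_le (feature D H t) h.ball.1 hα (b := b t) (fun i => ?_) (h.slack t) (h.finite t)
  simp only [inner_feature]
  exact h.margin t i

theorem svmObjective_nonneg (hC : 0 ≤ C) {f : (t : Fin T) → (m : Fin M) → H m} {θ : Fin M → ℝ}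
    {ξ : (t : Fin T) → Fin (D.N t) → ℝ} {b : Fin T → ℝ} (h : PrimalFeasible D s H f θ ξ b)
    (t : Fin T) : 0 ≤ svmObjective D C H f θ ξ t :=
  add_nonneg
    (Finset.sum_nonneg fun m _ => div_nonneg (sq_nonneg _) (mul_nonneg zero_le_two (h.ball.1 m)))
    (mul_nonneg hC (Finset.sum_nonneg fun i _ => h.slack t i))

/-- Strong duality of the multi-task problem with the kernel weights held fixed. -/
theorem exists_isGreatest_isLeast (hC : 0 ≤ C) (hp : 1 ≤ p) {θ : Fin M → ℝ}
    (hθ : θ ∈ posBall M s) :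
    ∃ v, IsGreatest (dualValuesAt D C p H θ) v ∧ IsLeast (primalValuesAt D C p s H θ) v := by
  choose α hα f ξ b hmargin hξ hf hval using fun t =>
    exists_svm_strong_duality (feature D H t) (θ := θ) hC (D.label t)
  have hfeas : PrimalFeasible D s H f θ ξ b :=
    { margin := fun t i => by simpa only [inner_feature] using hmargin t i
      slack := hξ
      ball := hθ
      finite := hf }
  have hobj : ∀ t, svmObjective D C H f θ ξ t = svmDual (feature D H t) (D.y t) θ (α t) := hval
  have hnn := svmObjective_nonneg hC hfeas
  have hnu := isGreatest_sum_mul hp hnn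
  -- The common value is the norm of the vector of single-task optima.
  refine ⟨nu p (svmObjective D C H f θ ξ), ⟨?_, ?_⟩, ⟨f, ξ, b, hfeas, rfl⟩, ?_⟩
  · obtain ⟨lam, hlam, h⟩ := hnu.1
    refine ⟨_, lam, dualFeasible_smul hα hlam, ?_⟩
    rw [h, Phi_smul]
    simp only [hobj]
  · rintro r ⟨β, lam, hβ, rfl⟩
    obtain ⟨α', hα', rfl⟩ := hβ.exists_eq_smul hC
    rw [Phi_smul]
    exact (Finset.sum_le_sum fun t _ => mul_le_mul_of_nonneg_left
      (svmDual_le_svmObjective hfeas t (hα' t)) (hβ.ball.1 t)).trans (hnu.2 ⟨lam, hβ.ball, rfl⟩)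
  · rintro r ⟨f', ξ', b', h', rfl⟩
    exact nu_mono hp hnn fun t => (hobj t).trans_le (svmDual_le_svmObjective h' t (hα t))

theorem innerMax_isGreatest_isLeast (hC : 0 ≤ C) (hp : 1 ≤ p) {θ : Fin M → ℝ}
    (hθ : θ ∈ posBall M s) :
    IsGreatest (dualValuesAt D C p H θ) (innerMax D C p H θ) ∧
      IsLeast (primalValuesAt D C p s H θ) (innerMax D C p H θ) := by
  obtain ⟨v, hg, hl⟩ := exists_isGreatest_isLeast (D := D) (H := H) hC hp hθ
  have hv : innerMax D C p H θ = v := hg.csSup_eq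
  rw [hv]
  exact ⟨hg, hl⟩

theorem continuous_Phi (β : (t : Fin T) → Fin (D.N t) → ℝ) (lam : Fin T → ℝ) :
    Continuous fun θ => Phi D H θ β lam := by
  unfold Phi
  simp only [quadratic_form_eq]
  fun_prop

/-- Freezing the maximizer `(β, lam)` found at `θ` gives a continuous minorant of `innerMax` on the
ball that touches it at `θ`. -/
theorem lowerSemicontinuousOn_innerMax (hC : 0 ≤ C) (hp : 1 ≤ p) :
    LowerSemicontinuousOn (innerMax D C p H) (posBall M s) := by
  intro θ hθ y hy
  obtain ⟨β, lam, hβ, hval⟩ := (innerMax_isGreatest_isLeast (D := D) (H := H) hC hp hθ).1.1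
  rw [hval] at hy
  have h := ((continuous_Phi (H := H) β lam).continuousAt (x := θ)).eventually (lt_mem_nhds hy)
  filter_upwards [h.filter_mono nhdsWithin_le_nhds, self_mem_nhdsWithin] with θ' h1 h2
  exact h1.trans_le ((innerMax_isGreatest_isLeast (D := D) (H := H) hC hp h2).1.2
    ⟨β, lam, hβ, rfl⟩)

theorem exists_innerMax_le (hC : 0 ≤ C) (hp : 1 ≤ p) (hs : 1 ≤ s) :
    ∃ θ ∈ posBall M s, ∀ θ' ∈ posBall M s, innerMax D C p H θ ≤ innerMax D C p H θ' := by
  obtain ⟨θ, hθ, hmin⟩ := (lowerSemicontinuousOn_innerMax (D := D) (H := H) hC hp).exists_isMinOn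
    ⟨0, zero_mem_posBall hs⟩ (isCompact_posBall hs)
  exact ⟨θ, hθ, fun θ' h' => hmin h'⟩

end MultiTask

end MTMKL

/-! ### Equivalence of the two problems -/

theorem mainTheorem2 {X : Type*} {T M : ℕ} (D : MTMKL.TrainingData X T)
    (C : ℝ) (hC : 0 < C) (p s : ℝ≥0∞) (hp : 1 ≤ p) (hs : 1 ≤ s)
    (H : Fin M → Type*) [∀ m, NormedAddCommGroup (H m)] [∀ m, InnerProductSpace ℝ (H m)]
    [∀ m, CompleteSpace (H m)] [∀ m, RKHS ℝ (H m) X ℝ] :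
    -- for every admissible `θ` the inner maximum is attained, and it is
    -- the attained minimum of the multi-task problem with `θ` fixed
    (∀ θ ∈ MTMKL.posBall M s,
      IsGreatest (MTMKL.dualValuesAt D C p H θ) (MTMKL.innerMax D C p H θ) ∧
      IsLeast (MTMKL.primalValuesAt D C p s H θ) (MTMKL.innerMax D C p H θ)) ∧
    -- both problems attain their optimal values, and these agree
    (∃ v : ℝ, IsLeast (MTMKL.primalValues D C p s H) v ∧
      IsLeast (MTMKL.innerMax D C p H '' MTMKL.posBall M s) v) ∧
    -- both problems have the same optimal `θ`
    (∀ θ : Fin M → ℝ,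
      (∃ f ξ b, MTMKL.IsPrimalSolution D C p s H f θ ξ b) ↔
      (∃ β lam, MTMKL.IsMinMaxSolution D C p s H θ β lam)) := by
  have hdual : ∀ θ ∈ MTMKL.posBall M s,
      IsGreatest (MTMKL.dualValuesAt D C p H θ) (MTMKL.innerMax D C p H θ) ∧
      IsLeast (MTMKL.primalValuesAt D C p s H θ) (MTMKL.innerMax D C p H θ) :=
    fun θ hθ => MTMKL.innerMax_isGreatest_isLeast hC.le hp hθ
  refine ⟨hdual, ?_, fun θ => ⟨?_, ?_⟩⟩
  · obtain ⟨θ, hθ, hmin⟩ := MTMKL.exists_innerMax_le (D := D) (H := H) hC.le hp hs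
    refine ⟨MTMKL.innerMax D C p H θ, ⟨?_, ?_⟩, ⟨θ, hθ, rfl⟩, ?_⟩
    · obtain ⟨f, ξ, b, h, hval⟩ := (hdual θ hθ).2.1
      exact ⟨f, θ, ξ, b, h, hval⟩
    · rintro r ⟨f, θ', ξ, b, h, rfl⟩
      exact (hmin θ' h.ball).trans ((hdual θ' h.ball).2.2 ⟨f, ξ, b, h, rfl⟩)
    · rintro r ⟨θ', hθ', rfl⟩
      exact hmin θ' hθ'
  · rintro ⟨f, ξ, b, h, hopt⟩
    obtain ⟨β, lam, hβ, hval⟩ := (hdual θ h.ball).1.1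
    refine ⟨β, lam, h.ball, hβ, fun β' lam' h' => ?_, fun θ' hθ' => ?_⟩
    · rw [← hval]
      exact (hdual θ h.ball).1.2 ⟨β', lam', h', rfl⟩
    · obtain ⟨f', ξ', b', h', hval'⟩ := (hdual θ' hθ').2.1
      rw [hval']
      exact ((hdual θ h.ball).2.2 ⟨f, ξ, b, h, rfl⟩).trans (hopt f' θ' ξ' b' h')
  · rintro ⟨β, lam, hθ, -, -, hmin⟩
    -- The given `(β, lam)` plays no role: the primal point comes from attainment at `θ`.
    obtain ⟨f, ξ, b, h, hval⟩ := (hdual θ hθ).2.1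
    refine ⟨f, ξ, b, h, fun f' θ' ξ' b' h' => ?_⟩
    rw [← hval]
    exact (hmin θ' h'.ball).trans ((hdual θ' h'.ball).2.2 ⟨f', ξ', b', h', rfl⟩)
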